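/- Let $V$ be a Euclidean space of dimension $n$ with inner product $\langle\cdot,\cdot\rangle$, and let $\Phi\subset V$ be an irreducible (reduced) crystallographic root system spanning $V$, with a system of simple roots $\alpha_1,\dots,\alpha_n$. Let $\tilde\alpha=\sum_{i=1}^n c_i\alpha_i$ be the highest root (the root of maximal height), let $h=1+\sum_{i=1}^n c_i$ be the Coxeter number, and normalize the inner product so that $\langle\tilde\alpha,\tilde\alpha\rangle=2$. Let $\check\omega_1,\dots,\check\omega_n$ be the basis of $V$ dual to the simple roots, i.e. $\langle\check\omega_i,\alpha_j\rangle=\delta_{i,j}$, let $\check\rho=\sum_{i=1}^n\check\omega_i$, let $$\check\Lambda=\{x\in V:\langle x,\alpha\rangle\in\mathbb Z\text{ for all }\alpha\in\Phi\}$$ be the coweight lattice, and let $$\mathcal A=\{x\in V:\langle x,\alpha_i\rangle\ge 0\text{ for }1\le i\le n\text{ and }\langle x,\tilde\alpha\rangle\le 1\}$$ be the fundamental alcove. For an integer $b\ge 0$ and $x\in V$ put $$\mathsf{size}^{(b)}(x)=\frac h2\left(\left\|x-\frac{b\check\rho}{h}\right\|^2-\left\|\frac{\check\rho}{h}\right\|^2\right).$$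 Then for every integer $b\ge 0$ the set $b\mathcal A\cap\check\Lambda$ is finite, and the weighted lattice point enumerator $$b\longmapsto\sum_{q\in b\mathcal A\cap\check\Lambda}\mathsf{size}^{(b)}(q)$$ is a quasipolynomial in $b$ of degree $n+2$ with period $c=\operatorname{lcm}(c_1,\dots,c_n)$: $c$ is positive, and there are real polynomials $p_i$ ($i\in\mathbb Z/c\mathbb Z$), each of degree exactly $n+2$, such that for every integer $b\ge 0$ the sum equals $p_{b\bmod c}(b)$. -/

import Mathlib

open Polynomial
open scoped Pointwise

/-- A root pairing between a real inner product space `V` and itself is Euclidean when it presents a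
root system inside `V` in the classical sense: the pairing is the inner product, and the coroot of
a root `α` is `2α / ‖α‖²`, so that the reflections of the root pairing are the orthogonal
reflections `x ↦ x - (2⟪α, x⟫ / ⟪α, α⟫) α`. -/
structure RootPairing.IsEuclidean {ι V : Type*} [NormedAddCommGroup V] [InnerProductSpace ℝ V]
    (P : RootPairing ι ℝ V V) : Prop where
  toLinearMap_apply : ∀ x y : V, P.toLinearMap x y = inner ℝ x y
  coroot_eq : ∀ i, P.coroot i = (2 / ‖P.root i‖ ^ 2) • P.root i

/-- `f` is a quasipolynomial of degree `d` with period `c`: on each of the `c` residue classes modulo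
`c` it agrees with a polynomial, and each of these `c` constituents has degree exactly `d`. -/
def IsQuasipolynomial (f : ℕ → ℝ) (d c : ℕ) : Prop :=
  0 < c ∧ ∃ p : ZMod c → ℝ[X],
    (∀ i, (p i).degree = d) ∧ ∀ b : ℕ, f b = (p (b : ZMod c)).eval (b : ℝ)

namespace RootPairing.Base

variable {ι V : Type*} [NormedAddCommGroup V] [InnerProductSpace ℝ V]
  {P : RootPairing ι ℝ V V} (Δ : P.Base)

section Coweights

variable [FiniteDimensional ℝ V] [P.IsRootSystem]

/-- The fundamental coweights: the basis of `V` dual to the basis of simple roots with respect to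
the inner product. -/
noncomputable def fundamentalCoweight (i : Δ.support) : V :=
  (InnerProductSpace.toDual ℝ V).symm (LinearMap.toContinuousLinearMap (Δ.toWeightBasis.coord i))

theorem inner_fundamentalCoweight [DecidableEq ι] (i j : Δ.support) :
    inner ℝ (Δ.fundamentalCoweight i) (P.root j) = if i = j then 1 else 0 := by
  have h : P.root j = Δ.toWeightBasis j := by simp
  rw [fundamentalCoweight, InnerProductSpace.toDual_symm_apply, h]
  simp [Finsupp.single_apply, eq_comm]

/-- The sum of the fundamental coweights. -/
noncomputable def rhoCheck : V :=
  ∑ i : Δ.support, Δ.fundamentalCoweight i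

end Coweights

section HighestRoot

variable [Finite ι] [Nonempty ι]

/-- (The index of) the highest root: a root of maximal height. -/
noncomputable def highestRoot : ι :=
  (Finite.exists_max Δ.height).choose

theorem height_le_highestRoot (i : ι) : Δ.height i ≤ Δ.height Δ.highestRoot :=
  (Finite.exists_max Δ.height).choose_spec i

theorem exists_highestRoot_eq_sum :
    ∃ c : ι → ℕ, P.root Δ.highestRoot = ∑ i ∈ Δ.support, c i • P.root i := by
  obtain ⟨f, -, hf | hf⟩ := Δ.exists_root_eq_sum_nat_or_neg Δ.highestRoot
  · exact ⟨f, hf⟩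
  · exfalso
    obtain ⟨i, hi⟩ := Δ.support_nonempty
    have h1 := Δ.height_le_highestRoot i
    rw [height_one_of_mem_support hi,
      height_eq_sum (f := fun j => -(f j : ℤ)) (by simpa using hf)] at h1
    have h2 : ∑ j ∈ Δ.support, -(f j : ℤ) ≤ 0 := Finset.sum_nonpos (by simp)
    omega

/-- The coefficients `cᵢ` in the expansion `∑ cᵢ αᵢ` of the highest root in the simple roots
`αᵢ`, `i ∈ Δ.support`. -/
noncomputable def highestRootCoeff : ι → ℕ :=
  Δ.exists_highestRoot_eq_sum.choose

theorem root_highestRoot :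
    P.root Δ.highestRoot = ∑ i ∈ Δ.support, Δ.highestRootCoeff i • P.root i :=
  Δ.exists_highestRoot_eq_sum.choose_spec

/-- The Coxeter number `h = 1 + ∑ cᵢ`, which is one more than the height of the highest root. -/
noncomputable def coxeterNumber : ℕ :=
  1 + ∑ i ∈ Δ.support, Δ.highestRootCoeff i

theorem coxeterNumber_eq : (Δ.coxeterNumber : ℤ) = 1 + Δ.height Δ.highestRoot := by
  rw [height_eq_sum (f := fun j => (Δ.highestRootCoeff j : ℤ)) (by simpa using Δ.root_highestRoot)]
  simp [coxeterNumber]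

/-- The least common multiple of the coefficients `cᵢ` of the highest root. -/
noncomputable def coeffLcm : ℕ :=
  Δ.support.lcm Δ.highestRootCoeff

/-- The fundamental alcove, cut out by `⟪x, α⟫ ≥ 0` for the simple roots `α` and by
`⟪x, α⟫ ≤ 1` for the highest root `α`. -/
def alcove : Set V :=
  {x | (∀ i ∈ Δ.support, 0 ≤ inner ℝ x (P.root i)) ∧ inner ℝ x (P.root Δ.highestRoot) ≤ 1}

/-- The statistic `size⁽ᵇ⁾(x) = (h / 2) (‖x - b ρ / h‖² - ‖ρ / h‖²)`, where `ρ` is the sum of the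
fundamental coweights. -/
noncomputable def size [FiniteDimensional ℝ V] [P.IsRootSystem] (b : ℕ) (x : V) : ℝ :=
  (Δ.coxeterNumber : ℝ) / 2 *
    (‖x - ((b : ℝ) / (Δ.coxeterNumber : ℝ)) • Δ.rhoCheck‖ ^ 2 -
      ‖((1 : ℝ) / (Δ.coxeterNumber : ℝ)) • Δ.rhoCheck‖ ^ 2)

end HighestRoot

end RootPairing.Base

/-- The coweight lattice: the vectors having integral inner product with every root. -/
def RootPairing.coweightLattice {ι V : Type*} [NormedAddCommGroup V] [InnerProductSpace ℝ V]
    (P : RootPairing ι ℝ V V) : Set V :=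
  {x | ∀ i, ∃ m : ℤ, inner ℝ x (P.root i) = m}

/-! Pairing with the simple roots identifies the coweights in the `b`-fold alcove with the points
`x` of `ℕⁿ` satisfying `∑ cᵢ xᵢ ≤ b`. This needs every `cᵢ` positive, which irreducibility provides
(`highestRootCoeff_pos`). The enumerator thus sums over a dilated simplex a polynomial that is
quadratic in `(x, b)` up to a constant.

Slicing the simplex by one coordinate turns the sum of a monomial into an iterated convolution `∑ₖ
kᵃ g(b - c k)`. Raising `b` by a multiple `L` of `c` changes such a convolution by finitely many
shifts of `g` and by convolutions with lower powers of `k`. Induction on `a` and discrete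
integration then give polynomiality modulo `L` (`sum_pow_mul`).

The degree is read off from growth. There are `O(bⁿ)` points, each of size `O(b²)`. Conversely,
sizes are bounded below uniformly, and a box with at least a constant times `bⁿ` points stays at
distance of order `b` from `bρ/h`. -/

/-- `f` agrees with a polynomial on each residue class modulo `L`. -/
def IsPolynomialMod (L : ℕ) (f : ℕ → ℝ) : Prop :=
  ∃ p : ZMod L → ℝ[X], ∀ b : ℕ, f b = (p (b : ZMod L)).eval (b : ℝ)

/-! ### Functions polynomial on residue classes. -/

namespace IsPolynomialMod

variable {L : ℕ} {f g : ℕ → ℝ}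

theorem add (hf : IsPolynomialMod L f) (hg : IsPolynomialMod L g) :
    IsPolynomialMod L (fun b => f b + g b) := by
  obtain ⟨p, hp⟩ := hf
  obtain ⟨q, hq⟩ := hg
  exact ⟨fun i => p i + q i, fun b => by simp [hp, hq]⟩

theorem mul (hf : IsPolynomialMod L f) (hg : IsPolynomialMod L g) :
    IsPolynomialMod L (fun b => f b * g b) := by
  obtain ⟨p, hp⟩ := hf
  obtain ⟨q, hq⟩ := hg
  exact ⟨fun i => p i * q i, fun b => by simp [hp, hq]⟩

theorem eval (p : ℝ[X]) : IsPolynomialMod L (fun b => p.eval (b : ℝ)) :=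
  ⟨fun _ => p, fun _ => rfl⟩

theorem const (a : ℝ) : IsPolynomialMod L (fun _ => a) := by
  simpa using eval (L := L) (C a)

theorem sum {α : Type*} (s : Finset α) {F : α → ℕ → ℝ}
    (h : ∀ a ∈ s, IsPolynomialMod L (F a)) : IsPolynomialMod L (fun b => ∑ a ∈ s, F a b) := by
  classical
  induction s using Finset.induction_on with
  | empty => simpa using const (L := L) 0
  | insert a s ha ih =>
    simp only [Finset.sum_insert ha]
    exact (h a (by simp)).add (ih fun x hx => h x (by simp [hx]))

theorem shift (hf : IsPolynomialMod L f) (t : ℕ) : IsPolynomialMod L (fun b => f (b + t)) := by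
  obtain ⟨p, hp⟩ := hf
  exact ⟨fun i => (p (i + t)).comp (X + C (t : ℝ)), fun b => by simp [hp]⟩

/-- Discrete integration of polynomials. -/
theorem exists_eval_eq_sum_range (q : ℝ[X]) :
    ∃ Q : ℝ[X], ∀ m : ℕ, ∑ j ∈ Finset.range m, q.eval (j : ℝ) = Q.eval (m : ℝ) := by
  induction q using Polynomial.induction_on' with
  | add p q hp hq =>
    obtain ⟨P, hP⟩ := hp
    obtain ⟨Q, hQ⟩ := hq
    exact ⟨P + Q, fun m => by simp [Finset.sum_add_distrib, hP, hQ]⟩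
  | monomial p a =>
    refine ⟨C a * ∑ i ∈ Finset.range (p + 1),
      C ((bernoulli i : ℝ) * ((p + 1).choose i) / (p + 1)) * X ^ (p + 1 - i), fun m => ?_⟩
    have h := congrArg (fun x : ℚ => (x : ℝ)) (sum_range_pow m p)
    push_cast at h
    simp only [eval_monomial, ← Finset.mul_sum, h, eval_mul, eval_C, eval_finsetSum, eval_pow,
      eval_X]
    congr 1
    exact Finset.sum_congr rfl fun i _ => by ring

/-- On the class of `r`, a polynomial in the quotient `m` is a polynomial in `b` through `m = (b -
r) / L`. -/
theorem of_residues (hL : 0 < L) (h : ∀ r < L, ∃ q : ℝ[X], ∀ m : ℕ, f (L * m + r) = q.eval (m : ℝ)) :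
    IsPolynomialMod L f := by
  have : NeZero L := ⟨hL.ne'⟩
  choose! q hq using h
  refine ⟨fun i => (q i.val).comp (C (1 / (L : ℝ)) * (X - C (i.val : ℝ))), fun b => ?_⟩
  have hb := Nat.div_add_mod b L
  have hL' : (L : ℝ) ≠ 0 := by exact_mod_cast hL.ne'
  have hb' : (b : ℝ) = L * (b / L : ℕ) + (b % L : ℕ) := by exact_mod_cast hb.symm
  have hm := hq (b % L) (Nat.mod_lt _ hL) (b / L)
  rw [hb] at hm
  rw [hm, eval_comp, ZMod.val_natCast]
  congr 1
  simp only [eval_mul, eval_sub, eval_C, eval_X]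
  rw [hb']
  rw [add_sub_cancel_right]
  field_simp

/-- A function whose `L`-step difference is polynomial modulo `L` is itself polynomial
modulo `L`. -/
theorem of_difference (hL : 0 < L) (h : IsPolynomialMod L fun b => f (b + L) - f b) :
    IsPolynomialMod L f := by
  obtain ⟨p, hp⟩ := h
  refine of_residues hL fun r _ => ?_
  -- Telescoping along `r, r + L, r + 2L, …` makes `f` its initial value plus a discrete integral of
  -- the difference.
  obtain ⟨Q, hQ⟩ := exists_eval_eq_sum_range ((p r).comp (C (L : ℝ) * X + C (r : ℝ)))
  refine ⟨C (f r) + Q, fun m => ?_⟩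
  rw [eval_add, ← hQ, eval_C]
  induction m with
  | zero => simp
  | succ m ih =>
    rw [Finset.sum_range_succ, ← add_assoc, ← ih]
    have := hp (L * m + r)
    simp only [Nat.cast_add, Nat.cast_mul, CharP.cast_eq_zero, zero_mul, zero_add] at this
    simp only [eval_comp, eval_add, eval_mul, eval_C, eval_X]
    rw [← this, show L * (m + 1) + r = L * m + r + L by ring]
    ring

/-- Convolution with a power along multiples of a divisor of the period. -/
theorem sum_pow_mul (hL : 0 < L) {c : ℕ} (hc : c ∣ L) (hg : IsPolynomialMod L g) (a : ℕ) :
    IsPolynomialMod L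
      (fun b => ∑ k ∈ Finset.range (b / c + 1), (k : ℝ) ^ a * g (b - c * k)) := by
  obtain ⟨e, rfl⟩ := hc
  have hc : 0 < c := Nat.pos_of_mul_pos_right hL
  have he : 0 < e := Nat.pos_of_mul_pos_left hL
  induction a using Nat.strong_induction_on with
  | _ a ih =>
  refine of_difference hL ?_
  -- The terms with `k < e` are new. The others are reindexed as `e + k`, which leaves the argument
  -- of `g` unchanged. In the binomial expansion of `(e + k)ᵃ` the top power cancels the old sum, so
  -- only exponents `i < a` remain.
  have key : ∀ b : ℕ,
      (∑ k ∈ Finset.range ((b + c * e) / c + 1), (k : ℝ) ^ a * g (b + c * e - c * k))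
        - ∑ k ∈ Finset.range (b / c + 1), (k : ℝ) ^ a * g (b - c * k)
      = (∑ k ∈ Finset.range e, (k : ℝ) ^ a * g (b + (c * e - c * k)))
        + ∑ i ∈ Finset.range a, ((e : ℝ) ^ (a - i) * (a.choose i)) *
          ∑ k ∈ Finset.range (b / c + 1), (k : ℝ) ^ i * g (b - c * k) := by
    intro b
    rw [Nat.add_mul_div_left _ _ hc, show b / c + e + 1 = e + (b / c + 1) by ring,
      Finset.sum_range_add, add_sub_assoc, ← Finset.sum_sub_distrib]
    congr 1
    · refine Finset.sum_congr rfl fun k hk => ?_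
      rw [Nat.add_sub_assoc (Nat.mul_le_mul_left c (Finset.mem_range.mp hk).le)]
    · simp_rw [Finset.mul_sum]
      rw [Finset.sum_comm]
      refine Finset.sum_congr rfl fun k _ => ?_
      rw [show b + c * e - c * (e + k) = b - c * k by rw [mul_add]; omega]
      push_cast
      rw [add_comm (e : ℝ), add_pow, Finset.sum_range_succ]
      simp only [Nat.sub_self, pow_zero, mul_one, Nat.choose_self, Nat.cast_one]
      rw [add_mul, add_sub_cancel_right, Finset.sum_mul]
      exact Finset.sum_congr rfl fun i _ => by ring
  simp_rw [key]
  exact (sum _ fun k _ => (const _).mul (hg.shift _)).add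
    (sum _ fun i hi => (const _).mul (ih i (Finset.mem_range.mp hi)))

end IsPolynomialMod

/-! ### Sums of polynomials over a dilated simplex. -/

/-- The lattice points `x` of the dilated simplex `x ≥ 0`, `∑ cᵢ xᵢ ≤ b`. -/
def simplexPoints {σ : Type*} [Fintype σ] [DecidableEq σ] (c : σ → ℕ) (b : ℕ) :
    Finset (σ → ℕ) :=
  {x ∈ Fintype.piFinset fun _ => Finset.range (b + 1) | ∑ i, c i * x i ≤ b}

section SimplexPoints

theorem le_of_sum_mul_le {σ : Type*} [Fintype σ] {c : σ → ℕ} (hc : ∀ i, 0 < c i) {b : ℕ} {x : σ → ℕ} (hx : ∑ i, c i * x i ≤ b)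
    (i : σ) : x i ≤ b :=
  calc x i ≤ c i * x i := Nat.le_mul_of_pos_left _ (hc i)
    _ ≤ ∑ j, c j * x j := Finset.single_le_sum (f := fun j => c j * x j)
        (fun _ _ => Nat.zero_le _) (Finset.mem_univ i)
    _ ≤ b := hx

variable {σ : Type*} [Fintype σ] [DecidableEq σ] {c : σ → ℕ}

/-- The bounding box in the definition only ensures finiteness: it is implied by the inequality once
all `c i` are positive. -/
theorem mem_simplexPoints (hc : ∀ i, 0 < c i) {b : ℕ} {x : σ → ℕ} :
    x ∈ simplexPoints c b ↔ ∑ i, c i * x i ≤ b := by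
  simp only [simplexPoints, Finset.mem_filter, Fintype.mem_piFinset, Finset.mem_range,
    and_iff_right_iff_imp]
  exact fun h i => Nat.lt_succ_of_le (le_of_sum_mul_le hc h i)

theorem card_simplexPoints_le (b : ℕ) :
    (simplexPoints c b).card ≤ (b + 1) ^ Fintype.card σ := by
  refine (Finset.card_filter_le _ _).trans ?_
  simp

theorem sum_simplexPoints_succ {n : ℕ} {c : Fin (n + 1) → ℕ} (hc : ∀ i, 0 < c i)
    (F : (Fin (n + 1) → ℕ) → ℝ) (b : ℕ) :
    ∑ x ∈ simplexPoints c b, F x =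
      ∑ k ∈ Finset.range (b / c 0 + 1), ∑ y ∈ simplexPoints (fun i => c (Fin.succ i)) (b - c 0 * k),
        F (Fin.cons k y) := by
  rw [Finset.sum_sigma']
  refine Finset.sum_nbij' (fun x => ⟨x 0, fun i => x i.succ⟩) (fun p => Fin.cons p.1 p.2)
    ?_ ?_ ?_ ?_ ?_
  · intro x hx
    rw [mem_simplexPoints hc, Fin.sum_univ_succ] at hx
    rw [Finset.mem_sigma, mem_simplexPoints fun i => hc _, Finset.mem_range, Nat.lt_succ_iff,
      Nat.le_div_iff_mul_le (hc 0), mul_comm]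
    dsimp only
    omega
  · rintro ⟨k, y⟩ h
    rw [Finset.mem_sigma, mem_simplexPoints fun i => hc _, Finset.mem_range, Nat.lt_succ_iff,
      Nat.le_div_iff_mul_le (hc 0), mul_comm] at h
    rw [mem_simplexPoints hc, Fin.sum_univ_succ]
    simp only [Fin.cons_zero, Fin.cons_succ]
    dsimp only at h
    omega
  · intro x _
    exact Fin.cons_self_tail x
  · rintro ⟨k, y⟩ _
    simp
  · intro x _
    exact congrArg F (Fin.cons_self_tail x).symm

/-- Each slice by the first coordinate is a smaller simplex, so the induction step is a convolution
with a power. -/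
theorem IsPolynomialMod.sum_simplexPoints_prod_pow {L : ℕ} (hL : 0 < L) {n : ℕ} {c : Fin n → ℕ}
    (hc : ∀ i, c i ∣ L) (a : Fin n → ℕ) :
    IsPolynomialMod L (fun b => ∑ x ∈ simplexPoints c b, ∏ i, (x i : ℝ) ^ a i) := by
  induction n with
  | zero => simpa [simplexPoints] using IsPolynomialMod.const 1
  | succ n ih =>
    simp_rw [sum_simplexPoints_succ fun i => Nat.pos_of_dvd_of_pos (hc i) hL, Fin.prod_univ_succ,
      Fin.cons_zero, Fin.cons_succ, ← Finset.mul_sum]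
    exact (ih (fun i => hc _) fun i => a i.succ).sum_pow_mul hL (hc 0) (a 0)

theorem IsPolynomialMod.sum_simplexPoints {L : ℕ} (hL : 0 < L) (hc : ∀ i, c i ∣ L)
    (F : MvPolynomial σ ℝ) :
    IsPolynomialMod L
      (fun b => ∑ x ∈ simplexPoints c b, MvPolynomial.eval (fun i => (x i : ℝ)) F) := by
  have hc₀ : ∀ i, 0 < c i := fun i => Nat.pos_of_dvd_of_pos (hc i) hL
  simp_rw [MvPolynomial.eval_eq']
  have : ∀ b, ∑ x ∈ simplexPoints c b, ∑ d ∈ F.support, F.coeff d * ∏ i, (x i : ℝ) ^ d i =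
      ∑ d ∈ F.support, F.coeff d * ∑ x ∈ simplexPoints c b, ∏ i, (x i : ℝ) ^ d i := by
    intro b
    rw [Finset.sum_comm]
    simp_rw [Finset.mul_sum]
  simp_rw [this]
  refine IsPolynomialMod.sum _ fun d _ => (IsPolynomialMod.const _).mul ?_
  let e := Fintype.equivFin σ
  have h := sum_simplexPoints_prod_pow hL (c := fun i => c (e.symm i)) (fun i => hc _)
    (fun i => d (e.symm i))
  convert h using 2 with b
  refine Finset.sum_nbij' (fun x i => x (e.symm i)) (fun y i => y (e i)) ?_ ?_ ?_ ?_ ?_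
  · intro x hx
    rw [mem_simplexPoints fun i => hc₀ _] at hx ⊢
    rwa [Equiv.sum_comp e.symm fun i => c i * x i]
  · intro y hy
    rw [mem_simplexPoints fun i => hc₀ _] at hy ⊢
    rw [← Equiv.sum_comp e.symm fun i => c i * y (e i)]
    simpa using hy
  · intro x _
    simp
  · intro y _
    simp
  · intro x _
    exact (Equiv.prod_comp e.symm fun i => (x i : ℝ) ^ d i).symm

end SimplexPoints

/-! ### Degree from growth. -/

open Filter Topology

/-- The quotient by `X ^ N` would tend to `0` for smaller degree and be unbounded for larger degree.
A sequence `u` suffices, as needed for a constituent controlled only on its own residue class. -/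
theorem Polynomial.degree_eq_of_eval_between {p : ℝ[X]} {u : ℕ → ℝ} (hu : Tendsto u atTop atTop)
    {N : ℕ} {ε K : ℝ} (hε : 0 < ε) (hlow : ∀ᶠ m in atTop, ε * u m ^ N ≤ p.eval (u m))
    (hup : ∀ᶠ m in atTop, p.eval (u m) ≤ K * u m ^ N) : p.degree = N := by
  have hX : (X ^ N : ℝ[X]) ≠ 0 := pow_ne_zero _ X_ne_zero
  have hpos : ∀ᶠ m in atTop, 0 < u m ^ N :=
    (hu.eventually_gt_atTop 0).mono fun m hm => pow_pos hm N
  rcases lt_trichotomy p.degree N with h | h | h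
  · exfalso
    have ht := (p.div_tendsto_atTop_zero_of_degree_lt (X ^ N) (by simpa using h)).comp hu
    obtain ⟨m, h1, h2, h3⟩ := ((ht.eventually_lt_const hε).and (hlow.and hpos)).exists
    simp only [Function.comp, eval_pow, eval_X, div_lt_iff₀ h3] at h1
    linarith
  · exact h
  · exfalso
    have ht := (p.abs_div_tendsto_atTop_atTop_of_degree_gt (X ^ N) (by simpa using h) hX).comp hu
    obtain ⟨m, h1, h2, h3, h4⟩ :=
      ((ht.eventually_gt_atTop K).and (hlow.and (hpos.and hup))).exists
    have h5 : 0 ≤ p.eval (u m) := by nlinarith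
    simp only [Function.comp, eval_pow, eval_X] at h1
    rw [abs_of_nonneg (div_nonneg h5 h3.le), lt_div_iff₀ h3] at h1
    linarith

/-- The degree of a function which is polynomial on residue classes can be read off from
two-sided growth bounds. -/
theorem IsPolynomialMod.isQuasipolynomial {L : ℕ} (hL : 0 < L) {f : ℕ → ℝ}
    (hf : IsPolynomialMod L f) {N : ℕ} {ε K : ℝ} (hε : 0 < ε)
    (hlow : ∀ᶠ b : ℕ in atTop, ε * (b : ℝ) ^ N ≤ f b)
    (hup : ∀ᶠ b : ℕ in atTop, f b ≤ K * (b : ℝ) ^ N) : IsQuasipolynomial f N L := by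
  have : NeZero L := ⟨hL.ne'⟩
  obtain ⟨p, hp⟩ := hf
  refine ⟨hL, p, fun i => ?_, hp⟩
  have hv : Tendsto (fun m : ℕ => L * m + i.val) atTop atTop :=
    tendsto_atTop_mono (fun m => (Nat.le_mul_of_pos_left m hL).trans (Nat.le_add_right _ _)) tendsto_id
  have hi : ∀ m : ℕ, ((L * m + i.val : ℕ) : ZMod L) = i := fun m => by simp
  have hval : ∀ m : ℕ, f (L * m + i.val) = (p i).eval (((L * m + i.val : ℕ) : ℝ)) := fun m => by
    rw [hp, hi]
  refine Polynomial.degree_eq_of_eval_between (tendsto_natCast_atTop_atTop.comp hv) hε ?_ ?_ (K := K)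
  · filter_upwards [hv.eventually hlow] with m hm
    rwa [hval] at hm
  · filter_upwards [hv.eventually hup] with m hm
    rwa [hval] at hm

/-! ### Positivity of the highest root coefficients. -/

namespace RootPairing.Base

variable {ι V : Type*} [NormedAddCommGroup V] [InnerProductSpace ℝ V]
  {P : RootPairing ι ℝ V V}

/-- Every simple root occurs in the highest root of an irreducible root system. -/
theorem highestRootCoeff_pos [Finite ι] [Nonempty ι] [P.IsCrystallographic] [P.IsReduced]
    [P.IsIrreducible] (Δ : P.Base) (i : Δ.support) : 0 < Δ.highestRootCoeff i := by
  obtain ⟨i₀, hi₀⟩ : ∃ i : Δ.support, 0 < Δ.highestRootCoeff i := by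
    by_contra! h
    refine P.ne_zero Δ.highestRoot ?_
    rw [Δ.root_highestRoot]
    refine Finset.sum_eq_zero fun j hj => ?_
    rw [Nat.le_zero.mp (h ⟨j, hj⟩), zero_smul]
  -- Positivity spreads along the Dynkin diagram. If `j` is a neighbour of `i` with coefficient `0`,
  -- the highest root pairs negatively with the coroot of `j`, so adding the root `j` gives a root
  -- of larger height.
  refine Δ.induction_on_cartanMatrix (fun i => 0 < Δ.highestRootCoeff i) hi₀ fun i j hi hji => ?_
  by_contra! hj
  have hj0 : Δ.highestRootCoeff j = 0 := Nat.le_zero.mp hj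
  have hij : (j : ι) ≠ i := by
    intro h
    rw [h] at hj0
    exact hi.ne' hj0
  have hsum : P.pairingIn ℤ Δ.highestRoot j =
      ∑ k ∈ Δ.support, (Δ.highestRootCoeff k : ℤ) * P.pairingIn ℤ k j :=
    FaithfulSMul.algebraMap_injective ℤ ℝ <| by
      simp_rw [algebraMap_pairingIn, map_sum, map_mul, ← root_coroot_eq_pairing,
        Δ.root_highestRoot, map_sum, map_nsmul, LinearMap.coe_sum, Finset.sum_apply,
        LinearMap.smul_apply, algebraMap_pairingIn, root_coroot_eq_pairing]
      simp
  have hneg : P.pairingIn ℤ Δ.highestRoot j < 0 := by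
    rw [hsum]
    refine Finset.sum_neg' (fun k hk => ?_) ⟨i, i.2, ?_⟩
    · rcases eq_or_ne k j with rfl | hkj
      · simp [hj0]
      · exact mul_nonpos_of_nonneg_of_nonpos (by positivity)
          (Δ.pairingIn_le_zero_of_ne hkj hk j.2)
    · refine mul_neg_of_pos_of_neg (by exact_mod_cast hi)
        (lt_of_le_of_ne (Δ.pairingIn_le_zero_of_ne hij.symm i.2 j.2) fun h => hji ?_)
      exact (P.pairingIn_eq_zero_iff (i := i) (j := j)).mp h
  have hone := height_one_of_mem_support (b := Δ) j.2
  have hmax := Δ.height_le_highestRoot j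
  -- The excluded case, highest root equal to `-αⱼ`, would make the maximal height `-1`, below that
  -- of `αⱼ`.
  obtain ⟨k, hk⟩ := P.root_add_root_mem_of_pairingIn_neg hneg fun h => by
    classical
    have h2 := height_eq_sum (b := Δ) (i := Δ.highestRoot)
      (f := fun k => if k = j then (-1 : ℤ) else 0) (by simp [h])
    simp only [Finset.sum_ite_eq', j.2, if_true] at h2
    omega
  have h1 := Δ.height_add hk
  have h2 := Δ.height_le_highestRoot k
  omega

theorem coeffLcm_pos [Finite ι] [Nonempty ι] [P.IsCrystallographic] [P.IsReduced]
    [P.IsIrreducible] (Δ : P.Base) : 0 < Δ.coeffLcm :=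
  Nat.pos_of_ne_zero <| by
    rw [coeffLcm, Ne, Finset.lcm_eq_zero_iff]
    rintro ⟨i, hi, h⟩
    exact (Δ.highestRootCoeff_pos ⟨i, hi⟩).ne' h

theorem inner_highestRoot [Finite ι] [Nonempty ι] (Δ : P.Base) (x : V) :
    inner ℝ x (P.root Δ.highestRoot) =
      ∑ i : Δ.support, (Δ.highestRootCoeff i : ℝ) * inner ℝ x (P.root i) := by
  rw [Δ.root_highestRoot, inner_sum, ← Finset.sum_coe_sort]
  simp [← Nat.cast_smul_eq_nsmul ℝ, inner_smul_right]

theorem coxeterNumber_pos [Finite ι] [Nonempty ι] (Δ : P.Base) : (0 : ℝ) < Δ.coxeterNumber := by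
  simp only [coxeterNumber]
  positivity

theorem card_support_eq_finrank [P.IsRootSystem] (Δ : P.Base) :
    Fintype.card Δ.support = Module.finrank ℝ V :=
  (Module.finrank_eq_card_basis Δ.toWeightBasis).symm

theorem ext_inner_root [P.IsRootSystem] {Δ : P.Base} {x y : V}
    (h : ∀ j : Δ.support, inner ℝ x (P.root j) = inner ℝ y (P.root j)) :
    x = y :=
  ext_inner_right ℝ fun v => LinearMap.congr_fun
    (Δ.toWeightBasis.ext (f₁ := innerₛₗ ℝ x) (f₂ := innerₛₗ ℝ y) fun j => by simpa using h j) v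

/-! ### The size statistic in coweight coordinates. -/

section Coweights

variable [FiniteDimensional ℝ V] [P.IsRootSystem] (Δ : P.Base)

/-- The coweight with natural coordinates `x` in the basis of fundamental coweights. -/
noncomputable def coweight (x : Δ.support → ℕ) : V :=
  ∑ i, (x i : ℝ) • Δ.fundamentalCoweight i

theorem inner_coweight (x : Δ.support → ℕ) (j : Δ.support) :
    inner ℝ (Δ.coweight x) (P.root j) = x j := by
  classical
  simp [coweight, sum_inner, inner_smul_left, inner_fundamentalCoweight]

theorem inner_rhoCheck (j : Δ.support) : inner ℝ Δ.rhoCheck (P.root j) = (1 : ℝ) := by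
  classical
  simp [rhoCheck, sum_inner, inner_fundamentalCoweight]

theorem coweight_injective : Function.Injective Δ.coweight := fun x y h => by
  ext j
  have := congrArg (fun v : V => inner ℝ v (P.root j)) h
  simpa [inner_coweight] using this

theorem coweight_mem_coweightLattice (x : Δ.support → ℕ) :
    Δ.coweight x ∈ P.coweightLattice := by
  intro i
  obtain ⟨f, -, hf | hf⟩ := Δ.exists_root_eq_sum_nat_or_neg i
  · refine ⟨∑ j : Δ.support, (f j : ℤ) * x j, ?_⟩
    rw [hf, inner_sum, ← Finset.sum_coe_sort]
    simp [← Nat.cast_smul_eq_nsmul ℝ, inner_smul_right, inner_coweight]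
  · refine ⟨-∑ j : Δ.support, (f j : ℤ) * x j, ?_⟩
    rw [hf, inner_neg_right, inner_sum, ← Finset.sum_coe_sort]
    simp [← Nat.cast_smul_eq_nsmul ℝ, inner_smul_right, inner_coweight]

variable [Finite ι] [Nonempty ι]

/-- Separates the dependence on `b` from that on `x`, so that each part can be summed over the
simplex on its own. -/
theorem size_coweight (b : ℕ) (x : Δ.support → ℕ) :
    Δ.size b (Δ.coweight x) =
      (Δ.coxeterNumber : ℝ) / 2 * ∑ i, ∑ j,
        inner ℝ (Δ.fundamentalCoweight i) (Δ.fundamentalCoweight j) * ((x i : ℝ) * x j) -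
      b * ∑ i, inner ℝ (Δ.fundamentalCoweight i) Δ.rhoCheck * (x i : ℝ) +
      ((b : ℝ) ^ 2 - 1) * (‖Δ.rhoCheck‖ ^ 2 / (2 * Δ.coxeterNumber)) := by
  have h1 : ∑ i, ∑ j, inner ℝ (Δ.fundamentalCoweight i) (Δ.fundamentalCoweight j) *
      ((x i : ℝ) * x j) = ‖Δ.coweight x‖ ^ 2 := by
    rw [← real_inner_self_eq_norm_sq, coweight, sum_inner]
    simp_rw [inner_sum, inner_smul_left, inner_smul_right]
    exact Finset.sum_congr rfl fun i _ => Finset.sum_congr rfl fun j _ => by simp; ring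
  have h2 : ∑ i, inner ℝ (Δ.fundamentalCoweight i) Δ.rhoCheck * (x i : ℝ) =
      inner ℝ (Δ.coweight x) Δ.rhoCheck := by
    rw [coweight, sum_inner]
    exact Finset.sum_congr rfl fun i _ => by simp [inner_smul_left, mul_comm]
  have hh := Δ.coxeterNumber_pos.ne'
  rw [h1, h2, size, norm_sub_sq_real, inner_smul_right, norm_smul, norm_smul, mul_pow, mul_pow]
  simp only [Real.norm_eq_abs, sq_abs]
  field_simp
  ring

theorem size_coweight_le {b : ℕ} {x : Δ.support → ℕ} (hx : ∀ i, x i ≤ b) :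
    Δ.size b (Δ.coweight x) ≤ (Δ.coxeterNumber : ℝ) / 2 *
      (∑ i, ‖Δ.fundamentalCoweight i‖ + ‖Δ.rhoCheck‖ / Δ.coxeterNumber) ^ 2 * (b : ℝ) ^ 2 := by
  have hh := Δ.coxeterNumber_pos
  have h1 : ‖Δ.coweight x‖ ≤ b * ∑ i, ‖Δ.fundamentalCoweight i‖ := by
    rw [Finset.mul_sum]
    refine norm_sum_le_of_le _ fun i _ => ?_
    rw [norm_smul, Real.norm_natCast]
    exact mul_le_mul_of_nonneg_right (by exact_mod_cast hx i) (norm_nonneg _)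
  have h2 : ‖Δ.coweight x - ((b : ℝ) / (Δ.coxeterNumber : ℝ)) • Δ.rhoCheck‖ ≤
      b * (∑ i, ‖Δ.fundamentalCoweight i‖ + ‖Δ.rhoCheck‖ / Δ.coxeterNumber) := by
    refine (norm_sub_le _ _).trans ?_
    rw [norm_smul, Real.norm_of_nonneg (by positivity), mul_add]
    exact add_le_add h1 (le_of_eq (by ring))
  rw [size, mul_assoc]
  refine mul_le_mul_of_nonneg_left ?_ (by positivity)
  rw [← mul_pow, mul_comm _ (b : ℝ)]
  exact (sub_le_self _ (by positivity)).trans (pow_le_pow_left₀ (norm_nonneg _) h2 2)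

theorem neg_le_size (b : ℕ) (x : V) :
    -((Δ.coxeterNumber : ℝ) / 2 * ‖((1 : ℝ) / (Δ.coxeterNumber : ℝ)) • Δ.rhoCheck‖ ^ 2) ≤
      Δ.size b x := by
  have hh := Δ.coxeterNumber_pos
  rw [size, mul_sub]
  have : 0 ≤ (Δ.coxeterNumber : ℝ) / 2 *
    ‖x - ((b : ℝ) / (Δ.coxeterNumber : ℝ)) • Δ.rhoCheck‖ ^ 2 := by positivity
  linarith

/-- The vector `bρ/h` pairs to `b/h` with `αᵢ`, so the two pairings differ by at least `b/(2h)`.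
Cauchy–Schwarz turns this into a distance. -/
theorem le_size_coweight {b : ℕ} {x : Δ.support → ℕ} (i : Δ.support)
    (hx : (x i : ℝ) ≤ b / (2 * Δ.coxeterNumber)) :
    (Δ.coxeterNumber : ℝ) / 2 * (b / (2 * Δ.coxeterNumber * ‖P.root i‖)) ^ 2 -
      (Δ.coxeterNumber : ℝ) / 2 * ‖((1 : ℝ) / (Δ.coxeterNumber : ℝ)) • Δ.rhoCheck‖ ^ 2 ≤
      Δ.size b (Δ.coweight x) := by
  have hh := Δ.coxeterNumber_pos
  have hα : 0 < ‖P.root i‖ := norm_pos_iff.mpr (P.ne_zero i)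
  rw [size, mul_sub]
  refine sub_le_sub_right (mul_le_mul_of_nonneg_left (pow_le_pow_left₀ (by positivity) ?_ 2)
    (by positivity)) _
  rw [← div_div, div_le_iff₀ hα]
  have h := abs_real_inner_le_norm
    (Δ.coweight x - ((b : ℝ) / (Δ.coxeterNumber : ℝ)) • Δ.rhoCheck) (P.root i)
  refine le_trans ?_ h
  rw [inner_sub_left, inner_smul_left, inner_coweight, inner_rhoCheck, abs_sub_comm]
  refine le_trans ?_ (le_abs_self _)
  have : (b : ℝ) / Δ.coxeterNumber = 2 * (b / (2 * Δ.coxeterNumber)) := by field_simp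
  simp only [map_div₀, map_natCast, mul_one]
  linarith

end Coweights

/-! ### Alcove points as simplex points, and growth of the enumerator. -/

section Irreducible

variable [Finite ι] [Nonempty ι] [P.IsCrystallographic] [P.IsReduced] [P.IsIrreducible]

theorem mem_smul_alcove (Δ : P.Base) [P.IsRootSystem] [FiniteDimensional ℝ V] (b : ℕ) (x : V) :
    x ∈ (b : ℝ) • Δ.alcove ↔
      (∀ i ∈ Δ.support, 0 ≤ inner ℝ x (P.root i)) ∧ inner ℝ x (P.root Δ.highestRoot) ≤ b := by
  -- Dilation by `0` collapses the alcove to the origin; the inequalities do the same because every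
  -- coefficient is positive.
  rcases Nat.eq_zero_or_pos b with rfl | hb
  · have h0 : (0 : V) ∈ Δ.alcove := by simp [alcove]
    rw [Nat.cast_zero, Set.zero_smul_set ⟨0, h0⟩, Set.mem_zero]
    refine ⟨by rintro rfl; simp, fun ⟨h1, h2⟩ => ?_⟩
    have hc : ∀ i : Δ.support, 0 < (Δ.highestRootCoeff i : ℝ) := fun i => by
      exact_mod_cast Δ.highestRootCoeff_pos i
    have hnn : ∀ i ∈ (Finset.univ : Finset Δ.support), 0 ≤ (Δ.highestRootCoeff i : ℝ) * inner ℝ x (P.root i) :=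
      fun i _ => mul_nonneg (hc i).le (h1 i i.2)
    rw [inner_highestRoot] at h2
    have h3 := (Finset.sum_eq_zero_iff_of_nonneg hnn).mp (le_antisymm h2 (Finset.sum_nonneg hnn))
    refine ext_inner_root (Δ := Δ) fun j => ?_
    simpa [(hc j).ne'] using h3 j (Finset.mem_univ j)
  · have hb' : (0 : ℝ) < b := by exact_mod_cast hb
    rw [Set.mem_smul_set_iff_inv_smul_mem₀ hb'.ne']
    simp only [alcove, Set.mem_ofPred_eq, inner_smul_left, map_inv₀, map_natCast,
      inv_mul_le_iff₀ hb', mul_one]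
    refine and_congr_left fun _ => forall₂_congr fun i _ => ?_
    exact mul_nonneg_iff_of_pos_left (inv_pos.mpr hb')

variable [DecidableEq ι] [P.IsRootSystem] [FiniteDimensional ℝ V] (Δ : P.Base)

theorem smul_alcove_inter_coweightLattice (b : ℕ) :
    ((b : ℝ) • Δ.alcove) ∩ P.coweightLattice =
      Δ.coweight '' (simplexPoints (fun i : Δ.support => Δ.highestRootCoeff i) b : Set _) := by
  ext x
  rw [Set.mem_inter_iff, mem_smul_alcove]
  constructor
  · rintro ⟨⟨h1, h2⟩, h3⟩
    choose m hm using h3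
    have hm' : ∀ i : Δ.support, inner ℝ x (P.root i) = ((m i).toNat : ℝ) := fun i => by
      have : 0 ≤ m i := by
        have := h1 i i.2
        rw [hm] at this
        exact_mod_cast this
      rw [hm]
      exact_mod_cast (Int.toNat_of_nonneg this).symm
    refine ⟨fun i => (m i).toNat, ?_, ?_⟩
    · rw [Finset.mem_coe, mem_simplexPoints Δ.highestRootCoeff_pos]
      rw [inner_highestRoot] at h2
      simp_rw [hm'] at h2
      exact_mod_cast h2
    · exact ext_inner_root (Δ := Δ) fun j => by rw [inner_coweight, hm']
  · rintro ⟨y, hy, rfl⟩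
    rw [Finset.mem_coe, mem_simplexPoints Δ.highestRootCoeff_pos] at hy
    refine ⟨⟨fun i hi => ?_, ?_⟩, Δ.coweight_mem_coweightLattice y⟩
    · rw [Δ.inner_coweight y ⟨i, hi⟩]
      positivity
    · rw [inner_highestRoot]
      simp_rw [inner_coweight]
      exact_mod_cast hy

theorem finsum_size_eq_sum (b : ℕ) :
    ∑ᶠ q ∈ ((b : ℝ) • Δ.alcove) ∩ P.coweightLattice, Δ.size b q =
      ∑ x ∈ simplexPoints (fun i : Δ.support => Δ.highestRootCoeff i) b,
        Δ.size b (Δ.coweight x) := by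
  rw [smul_alcove_inter_coweightLattice, finsum_mem_image Δ.coweight_injective.injOn,
    finsum_mem_coe_finset]

theorem isPolynomialMod_sum_size :
    IsPolynomialMod Δ.coeffLcm fun b =>
      ∑ x ∈ simplexPoints (fun i : Δ.support => Δ.highestRootCoeff i) b,
        Δ.size b (Δ.coweight x) := by
  have key := fun F : MvPolynomial Δ.support ℝ => IsPolynomialMod.sum_simplexPoints
    (c := fun i : Δ.support => Δ.highestRootCoeff i) Δ.coeffLcm_pos
    (fun i => Finset.dvd_lcm i.2) F
  simp_rw [size_coweight, Finset.sum_add_distrib, Finset.sum_sub_distrib, ← Finset.mul_sum,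
    Finset.sum_const, nsmul_eq_mul]
  have h2 := key (∑ i, ∑ j, MvPolynomial.C
    (inner ℝ (Δ.fundamentalCoweight i) (Δ.fundamentalCoweight j)) *
      (MvPolynomial.X i * MvPolynomial.X j))
  have h1 := key (∑ i, MvPolynomial.C (inner ℝ (Δ.fundamentalCoweight i) Δ.rhoCheck) *
    MvPolynomial.X i)
  have h0 := key 1
  simp only [map_sum, map_mul, MvPolynomial.eval_C, MvPolynomial.eval_X, map_one,
    Finset.sum_const, nsmul_eq_mul, mul_one] at h2 h1 h0
  have hd := (((IsPolynomialMod.const ((Δ.coxeterNumber : ℝ) / 2)).mul h2).add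
    ((IsPolynomialMod.eval (-X)).mul h1)).add (h0.mul (IsPolynomialMod.eval
      ((X ^ 2 - 1) * C (‖Δ.rhoCheck‖ ^ 2 / (2 * Δ.coxeterNumber)))))
  convert hd using 2 with b
  simp
  ring

theorem exists_sum_size_le :
    ∃ K : ℝ, ∀ᶠ b : ℕ in atTop,
      ∑ x ∈ simplexPoints (fun i : Δ.support => Δ.highestRootCoeff i) b,
        Δ.size b (Δ.coweight x) ≤ K * (b : ℝ) ^ (Module.finrank ℝ V + 2) := by
  set M := (Δ.coxeterNumber : ℝ) / 2 *
      (∑ i, ‖Δ.fundamentalCoweight i‖ + ‖Δ.rhoCheck‖ / Δ.coxeterNumber) ^ 2 with hM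
  have hM0 : 0 ≤ M := by positivity
  refine ⟨2 ^ Module.finrank ℝ V * M, ?_⟩
  filter_upwards [eventually_ge_atTop 1] with b hb
  have hcard : ((simplexPoints (fun i : Δ.support => Δ.highestRootCoeff i) b).card : ℝ) ≤
      (2 * b : ℝ) ^ Module.finrank ℝ V := by
    have h := card_simplexPoints_le (c := fun i : Δ.support => Δ.highestRootCoeff i) b
    rw [card_support_eq_finrank] at h
    have h' := h.trans (Nat.pow_le_pow_left (show b + 1 ≤ 2 * b by omega) _)
    exact_mod_cast h'
  refine (Finset.sum_le_card_nsmul _ _ (M * (b : ℝ) ^ 2) fun x hx => ?_).trans ?_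
  · rw [mem_simplexPoints Δ.highestRootCoeff_pos] at hx
    exact Δ.size_coweight_le (le_of_sum_mul_le Δ.highestRootCoeff_pos hx)
  · rw [nsmul_eq_mul]
    refine (mul_le_mul_of_nonneg_right hcard (by positivity)).trans (le_of_eq ?_)
    rw [mul_pow, pow_add]
    ring

theorem exists_le_sum_size :
    ∃ ε : ℝ, 0 < ε ∧ ∀ᶠ b : ℕ in atTop, ε * (b : ℝ) ^ (Module.finrank ℝ V + 2) ≤
      ∑ x ∈ simplexPoints (fun i : Δ.support => Δ.highestRootCoeff i) b,
        Δ.size b (Δ.coweight x) := by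
  set n := Module.finrank ℝ V
  have hh := Δ.coxeterNumber_pos
  obtain ⟨i, hi⟩ := Δ.support_nonempty
  have hα : 0 < ‖P.root i‖ := norm_pos_iff.mpr (P.ne_zero i)
  set h := Δ.coxeterNumber with hdef
  set κ := (h : ℝ) / 2 * ‖((1 : ℝ) / (h : ℝ)) • Δ.rhoCheck‖ ^ 2 with hκ
  have hκ0 : 0 ≤ κ := by positivity
  set δ := (h : ℝ) / 2 * (1 / (2 * h * ‖P.root i‖)) ^ 2 with hδ
  have hδ0 : 0 < δ := by positivity
  set ε := (1 / (2 * h) : ℝ) ^ n * δ with hε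
  have hε0 : 0 < ε := by positivity
  refine ⟨ε / 2, by positivity, ?_⟩
  -- Adding `κ` makes every size nonnegative; past this threshold the total correction, at most `κ
  -- (2b)ⁿ`, costs no more than half of the main term.
  have hbig : ∀ᶠ b : ℕ in atTop, 2 ^ n * κ / (ε / 2) ≤ (b : ℝ) :=
    tendsto_natCast_atTop_atTop.eventually_ge_atTop _
  filter_upwards [eventually_ge_atTop 1, hbig] with b hb hbκ
  have hb1 : (1 : ℝ) ≤ b := by exact_mod_cast hb
  set D := simplexPoints (fun i : Δ.support => Δ.highestRootCoeff i) b with hD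
  -- On this box `∑ cⱼ xⱼ ≤ (h - 1) b/(2h) ≤ b/2`, so it lies in the simplex, and all its points are
  -- far from `bρ/h`.
  set T : Finset (Δ.support → ℕ) := Fintype.piFinset fun _ => Finset.range (b / (2 * h) + 1)
  have hTmem : ∀ x ∈ T, ∀ j, (x j : ℝ) ≤ b / (2 * h) := fun x hx j => by
    have := Nat.lt_succ_iff.mp (Finset.mem_range.mp (Fintype.mem_piFinset.mp hx j))
    have h' : (x j : ℝ) ≤ ((b / (2 * h) : ℕ) : ℝ) := by exact_mod_cast this
    refine h'.trans ?_
    have := Nat.cast_div_le (α := ℝ) (m := b) (n := 2 * h)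
    simpa using this
  have hTD : T ⊆ D := fun x hx => by
    rw [hD, mem_simplexPoints Δ.highestRootCoeff_pos]
    have h1 : ((∑ j : Δ.support, Δ.highestRootCoeff j * x j : ℕ) : ℝ) ≤ b := by
      push_cast
      have h2 : (h : ℝ) = 1 + ∑ j : Δ.support, (Δ.highestRootCoeff j : ℝ) := by
        rw [hdef, coxeterNumber, ← Finset.sum_coe_sort]
        push_cast
        rfl
      calc ∑ j : Δ.support, (Δ.highestRootCoeff j : ℝ) * x j
          ≤ ∑ j : Δ.support, (Δ.highestRootCoeff j : ℝ) * (b / (2 * h)) :=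
            Finset.sum_le_sum fun j _ => mul_le_mul_of_nonneg_left (hTmem x hx j) (by positivity)
        _ = (h - 1) * (b / (2 * h)) := by rw [← Finset.sum_mul, h2]; ring
        _ ≤ h * (b / (2 * h)) := mul_le_mul_of_nonneg_right (by linarith) (by positivity)
        _ = b / 2 := by field_simp
        _ ≤ b := by linarith
    exact_mod_cast h1
  have hTcard : (b / (2 * h) : ℝ) ^ n ≤ T.card := by
    have : T.card = (b / (2 * h) + 1) ^ n := by
      simp only [T, Fintype.card_piFinset, Finset.card_range, Finset.prod_const, Finset.card_univ,
        n, card_support_eq_finrank]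
    rw [this]
    push_cast
    refine pow_le_pow_left₀ (by positivity) ?_ n
    have := (Nat.lt_floor_add_one ((b : ℝ) / ((2 * h : ℕ) : ℝ))).le
    rw [Nat.floor_div_eq_div] at this
    simpa using this
  have hDcard : (D.card : ℝ) ≤ 2 ^ n * (b : ℝ) ^ n := by
    have h1 := card_simplexPoints_le (c := fun i : Δ.support => Δ.highestRootCoeff i) b
    rw [card_support_eq_finrank] at h1
    have h2 := h1.trans (Nat.pow_le_pow_left (show b + 1 ≤ 2 * b by omega) _)
    rw [← mul_pow]
    exact_mod_cast h2
  have hsum : (T.card : ℝ) * (δ * (b : ℝ) ^ 2) ≤ ∑ x ∈ D, (Δ.size b (Δ.coweight x) + κ) := by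
    rw [← nsmul_eq_mul]
    refine (Finset.card_nsmul_le_sum T _ _ fun x hx => ?_).trans
      (Finset.sum_le_sum_of_subset_of_nonneg hTD fun x _ _ => ?_)
    · have := Δ.le_size_coweight ⟨i, hi⟩ (hTmem x hx ⟨i, hi⟩)
      refine le_trans (le_of_eq ?_) (sub_le_iff_le_add.mp this)
      rw [hδ]
      ring
    · have := Δ.neg_le_size b (Δ.coweight x)
      linarith
  rw [Finset.sum_add_distrib, Finset.sum_const, nsmul_eq_mul] at hsum
  have hmain : ε * (b : ℝ) ^ (n + 2) ≤ (T.card : ℝ) * (δ * (b : ℝ) ^ 2) := by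
    refine le_trans (le_of_eq ?_) (mul_le_mul_of_nonneg_right hTcard (by positivity))
    rw [hε, div_eq_mul_one_div (b : ℝ), mul_pow, pow_add]
    ring
  have herr : (D.card : ℝ) * κ ≤ ε / 2 * (b : ℝ) ^ (n + 2) := by
    rw [div_le_iff₀ (by positivity)] at hbκ
    calc (D.card : ℝ) * κ ≤ 2 ^ n * (b : ℝ) ^ n * κ := mul_le_mul_of_nonneg_right hDcard hκ0
      _ = 2 ^ n * κ * (b : ℝ) ^ n := by ring
      _ ≤ b * (ε / 2) * (b : ℝ) ^ n := mul_le_mul_of_nonneg_right hbκ (by positivity)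
      _ = ε / 2 * (b : ℝ) ^ (n + 1) := by ring
      _ ≤ ε / 2 * (b : ℝ) ^ (n + 2) :=
        mul_le_mul_of_nonneg_left (pow_le_pow_right₀ hb1 (by omega)) (by positivity)
  linarith

end Irreducible

end RootPairing.Base

theorem proposition7p2 {ι V : Type*} [Finite ι] [Nonempty ι]
    [NormedAddCommGroup V] [InnerProductSpace ℝ V] [FiniteDimensional ℝ V]
    (P : RootPairing ι ℝ V V) [P.IsRootSystem] [P.IsCrystallographic] [P.IsReduced]
    [P.IsIrreducible] (hP : P.IsEuclidean) (Δ : P.Base)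
    (hnorm : inner ℝ (P.root Δ.highestRoot) (P.root Δ.highestRoot) = (2 : ℝ)) :
    (∀ b : ℕ, (((b : ℝ) • Δ.alcove) ∩ P.coweightLattice).Finite) ∧
      IsQuasipolynomial
        (fun b : ℕ => ∑ᶠ q ∈ ((b : ℝ) • Δ.alcove) ∩ P.coweightLattice, Δ.size b q)
        (Module.finrank ℝ V + 2) Δ.coeffLcm := by

  classical
  refine ⟨fun b => ?_, ?_⟩
  · rw [Δ.smul_alcove_inter_coweightLattice]
    exact (Finset.finite_toSet _).image _
  · simp_rw [Δ.finsum_size_eq_sum]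
    obtain ⟨K, hK⟩ := Δ.exists_sum_size_le
    obtain ⟨ε, hε, hlow⟩ := Δ.exists_le_sum_size
    exact Δ.isPolynomialMod_sum_size.isQuasipolynomial Δ.coeffLcm_pos hε hlow hK
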